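/- All random variables are real-valued. For an integrable random variable $X$ and $k\ge 1$ let $X_1,\dots,X_k$ be iid copies of $X$, let $\mu_k(X)=\mathbb E\max_i X_i$ be the expected maxima and $\rho_k(X)=\mathbb E[\max_i X_i-\min_i X_i]$ the expected ranges of $X$. Let $F_X$ be the distribution function of $X$ and $F_X^{-1}(u)=\inf\{x:F_X(x)\ge u\}$, $0<u<1$, its generalized inverse; $F_X^{-1}(t+)$ denotes the right-hand limit of $F_X^{-1}$ at $t\in(0,1)$. Call $X$ symmetric if $X$ and $-X$ have the same distribution. (i) A real sequence $\{\rho_k\}_{k\ge1}$ is the sequence of expected ranges of some integrable random variable if and only if it is the sequence of expected maxima of some symmetric integrable random variable. (ii) For every integrable $Y$ there exists a symmetric integrable $X$, unique in distribution, with $\rho_k(X)=\rho_k(Y)$ for all $k\ge 1$; moreover $$F_X^{-1}(u)=\tfrac12\left[F_Y^{-1}(u)-F_Y^{-1}((1-u)+)\right],\qquad 0<u<1.$$ (iii) For integrable $X$ and $Y$ the following are equivalent: (a) $\rho_k(X)=\rho_k(Y)$ for all $k\ge 1$; (b) for all $u\in(0,1)$, $$F_X^{-1}(u)-F_Y^{-1}(u)=F_X^{-1}((1-u)+)-F_Y^{-1}((1-u)+);$$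 (c) the function $h=F_X^{-1}-F_Y^{-1}$ satisfies $h(u)=h(1-u)$ for almost all $u\in(0,1)$. -/

import Mathlib

open MeasureTheory ProbabilityTheory Set

universe u₁ u₂ u₃

noncomputable section

/-- `E max(X₁, …, X_k)` for `k` iid copies of the random variable `X` on `(Ω, P)`. The iid copies are
the coordinate copies `ω ↦ X (ω i)`, `i : Fin k`, on the product probability space `(Ω, P)^k`.
Meaningful for `k ≥ 1`. -/
def expectedMax {Ω : Type*} [MeasurableSpace Ω] (P : Measure Ω) (X : Ω → ℝ) (k : ℕ) : ℝ :=
  ∫ ω : Fin k → Ω, (⨆ i, X (ω i)) ∂(Measure.pi fun _ : Fin k => P)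

/-- `E R_k(X) = E [max(X₁, …, X_k) - min(X₁, …, X_k)]` for `k` iid copies of the random variable `X`
on `(Ω, P)`. Meaningful for `k ≥ 1`. -/
def expectedRange {Ω : Type*} [MeasurableSpace Ω] (P : Measure Ω) (X : Ω → ℝ) (k : ℕ) : ℝ :=
  ∫ ω : Fin k → Ω, ((⨆ i, X (ω i)) - ⨅ i, X (ω i)) ∂(Measure.pi fun _ : Fin k => P)

/-- `X` is symmetric around zero: `X` and `-X` have the same distribution. -/
def IsSymmetricRV {Ω : Type*} [MeasurableSpace Ω] (P : Measure Ω) (X : Ω → ℝ) : Prop :=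
  IdentDistrib X (fun ω => -X ω) P P

/-- The sequence `ρ₁, ρ₂, …` is the sequence of expected ranges of some integrable random variable.
(The value `ρ 0` is irrelevant.) -/
def IsExpectedRangesSeq.{u} (ρ : ℕ → ℝ) : Prop :=
  ∃ (Ω : Type u) (_ : MeasurableSpace Ω) (P : Measure Ω) (X : Ω → ℝ),
    IsProbabilityMeasure P ∧ Integrable X P ∧ ∀ k : ℕ, 1 ≤ k → expectedRange P X k = ρ k

/-- The sequence `ρ₁, ρ₂, …` is the sequence of expected maxima of some integrable random variable
that is symmetric around zero. (The value `ρ 0` is irrelevant.) -/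
def IsSymmetricExpectedMaximaSeq.{u} (ρ : ℕ → ℝ) : Prop :=
  ∃ (Ω : Type u) (_ : MeasurableSpace Ω) (P : Measure Ω) (X : Ω → ℝ),
    IsProbabilityMeasure P ∧ Integrable X P ∧ IsSymmetricRV P X ∧
      ∀ k : ℕ, 1 ≤ k → expectedMax P X k = ρ k

/-- The two random variables have the same expected ranges `E R_k`, `k = 1, 2, …`. -/
def SameExpectedRanges {Ω Ω' : Type*} [MeasurableSpace Ω] [MeasurableSpace Ω']
    (P : Measure Ω) (X : Ω → ℝ) (Q : Measure Ω') (Y : Ω' → ℝ) : Prop :=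
  ∀ k : ℕ, 1 ≤ k → expectedRange P X k = expectedRange Q Y k

/-- The generalized (left continuous) inverse `F_X⁻¹(u) = inf {x | F_X(x) ≥ u}`, `0 < u < 1`, of the
distribution function `F_X` of `X`. -/
def invCdf {Ω : Type*} [MeasurableSpace Ω] (P : Measure Ω) (X : Ω → ℝ) (u : ℝ) : ℝ :=
  sInf {x : ℝ | u ≤ cdf (P.map X) x}

end

open Filter Topology

/-! Represent `X` by its quantile function `p` on the unit interval. A monotone `p` commutes with
maxima, and the largest of `n + 1` uniform variables has density `(n + 1) u ^ n`; since `-X` is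
represented by `-p (1 - u)`, the expected range of `n + 1` copies is `(n + 1) ∫ u ^ n (p u - p (1 -
u))` (`expectedRange_eq_integral`). Expected ranges are thus moments of the odd part of `p` about `1
/ 2`, and moments determine an integrable function almost everywhere, by Weierstrass approximation
(`ae_eq_zero_of_moments_eq_zero`). This is (c). Left continuity of quantile functions turns it into
the pointwise (b), reflection exchanging left and right limits (`eq_rightLim_of_ae_eq`).

For (ii), the odd part of `p`, normalized by right limits, is half the sum of the quantile functions
of `Y` and `-Y`, so it is itself a quantile function, and its law is symmetric. A symmetric variable
has an almost everywhere odd quantile function, which gives uniqueness. For (i), the expected range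
of a symmetric variable is twice its expected maximum, so rescaling by `2` suffices. -/

/-- The uniform distribution on the unit interval. -/
noncomputable abbrev uniform01 : Measure ℝ := volume.restrict (Ioo (0 : ℝ) 1)

/-- The left continuous generalized inverse of the distribution function of `μ`. -/
noncomputable def quantile (μ : Measure ℝ) (u : ℝ) : ℝ := sInf {x : ℝ | u ≤ cdf μ x}

theorem invCdf_eq_quantile {Ω : Type*} [MeasurableSpace Ω] (P : Measure Ω) (X : Ω → ℝ) :
    invCdf P X = quantile (P.map X) := rfl

instance isProbabilityMeasure_uniform01 : IsProbabilityMeasure uniform01 :=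
  ⟨by simp [uniform01]⟩

theorem uniform01_Iic {t : ℝ} (ht : t ∈ Icc (0 : ℝ) 1) :
    uniform01 (Iic t) = ENNReal.ofReal t := by
  rw [uniform01, Measure.restrict_congr_set Ioo_ae_eq_Ioc, Measure.restrict_apply measurableSet_Iic,
    Iic_inter_Ioc_of_le ht.2, Real.volume_Ioc, sub_zero]

theorem ae_mem_uniform01 : ∀ᵐ u ∂uniform01, u ∈ Ioo (0 : ℝ) 1 :=
  ae_restrict_mem measurableSet_Ioo

theorem one_sub_mem_Ioo {u : ℝ} (hu : u ∈ Ioo (0 : ℝ) 1) : 1 - u ∈ Ioo (0 : ℝ) 1 :=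
  ⟨by linarith [hu.2], by linarith [hu.1]⟩

theorem measurePreserving_one_sub_uniform01 :
    MeasurePreserving (fun u : ℝ => 1 - u) uniform01 uniform01 := by
  have h := (Measure.measurePreserving_sub_left (volume : Measure ℝ) 1).restrict_preimage
    (measurableSet_Ioo (a := (0 : ℝ)) (b := 1))
  have e : (fun u : ℝ => 1 - u) ⁻¹' Ioo 0 1 = Ioo 0 1 := by
    ext u
    simp only [mem_preimage, mem_Ioo]
    constructor <;> rintro ⟨_, _⟩ <;> constructor <;> linarith
  rwa [e] at h

/-! ### Quantile functions, one-sided limits and reflection -/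

section Quantile

/-- Right continuity of the distribution function makes the infimum attained; this yields the Galois
connection behind all facts on quantiles. -/
theorem quantile_le_iff (μ : Measure ℝ) {u : ℝ} (hu : u ∈ Ioo (0 : ℝ) 1) (x : ℝ) :
    quantile μ u ≤ x ↔ u ≤ cdf μ x := by
  have hbdd : BddBelow {x : ℝ | u ≤ cdf μ x} := by
    obtain ⟨a, ha⟩ := ((tendsto_cdf_atBot μ).eventually_lt_const hu.1).exists
    refine ⟨a, fun y hy => ?_⟩
    by_contra! h
    exact absurd (monotone_cdf μ h.le) (not_le.2 (ha.trans_le hy))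
  have hne : {x : ℝ | u ≤ cdf μ x}.Nonempty := by
    obtain ⟨a, ha⟩ := ((tendsto_cdf_atTop μ).eventually_const_lt hu.2).exists
    exact ⟨a, ha.le⟩
  refine ⟨fun h => ?_, fun h => csInf_le hbdd h⟩
  have hright : Tendsto (cdf μ) (𝓝[>] x) (𝓝 (cdf μ x)) :=
    ((cdf μ).right_continuous x).tendsto.mono_left (nhdsWithin_mono _ Ioi_subset_Ici_self)
  refine ge_of_tendsto hright ?_
  filter_upwards [self_mem_nhdsWithin] with y hy
  obtain ⟨z, hz, hzy⟩ := exists_lt_of_csInf_lt hne (lt_of_le_of_lt h hy)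
  exact le_trans hz (monotone_cdf μ hzy.le)

theorem monotoneOn_quantile (μ : Measure ℝ) : MonotoneOn (quantile μ) (Ioo 0 1) := by
  intro u hu v hv huv
  rw [quantile_le_iff μ hu]
  exact huv.trans ((quantile_le_iff μ hv _).1 le_rfl)

theorem tendsto_quantile_nhdsLT (μ : Measure ℝ) {u : ℝ} (hu : u ∈ Ioo (0 : ℝ) 1) :
    Tendsto (quantile μ) (𝓝[<] u) (𝓝 (quantile μ u)) := by
  have hmem : Ioo 0 u ∈ 𝓝[<] u := Ioo_mem_nhdsLT hu.1
  refine tendsto_order.2 ⟨fun a ha => ?_, fun a ha => ?_⟩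
  · have h : cdf μ a < u := by
      rw [← not_le, ← quantile_le_iff μ hu, not_le]; exact ha
    filter_upwards [hmem, Ioo_mem_nhdsLT h] with v hv hv'
    rw [← not_le, quantile_le_iff μ ⟨hv.1, hv.2.trans hu.2⟩, not_le]
    exact hv'.1
  · filter_upwards [hmem] with v hv
    exact (monotoneOn_quantile μ ⟨hv.1, hv.2.trans hu.2⟩ hu hv.2.le).trans_lt ha

theorem MonotoneOn.aemeasurable_uniform01 {p : ℝ → ℝ} (hp : MonotoneOn p (Ioo 0 1)) :
    AEMeasurable p uniform01 :=
  aemeasurable_restrict_of_monotoneOn measurableSet_Ioo hp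

theorem map_quantile (μ : Measure ℝ) [IsProbabilityMeasure μ] :
    uniform01.map (quantile μ) = μ := by
  have hq := (monotoneOn_quantile μ).aemeasurable_uniform01
  have := Measure.isProbabilityMeasure_map hq
  refine Measure.ext_of_Iic _ _ fun x => ?_
  rw [Measure.map_apply_of_aemeasurable hq measurableSet_Iic, ← ofReal_cdf μ x,
    ← uniform01_Iic ⟨cdf_nonneg μ x, cdf_le_one μ x⟩]
  refine measure_congr ?_
  filter_upwards [ae_mem_uniform01] with u hu
  exact propext (quantile_le_iff μ hu x)

/-- A monotone function on the unit interval is the quantile function of its law at every point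
of left continuity. -/
theorem quantile_map_uniform01 {p : ℝ → ℝ} (hp : MonotoneOn p (Ioo 0 1)) {u : ℝ}
    (hu : u ∈ Ioo (0 : ℝ) 1) (hl : Tendsto p (𝓝[<] u) (𝓝 (p u))) :
    quantile (uniform01.map p) u = p u := by
  have hm := hp.aemeasurable_uniform01
  have := Measure.isProbabilityMeasure_map hm
  have key : ∀ x, quantile (uniform01.map p) u ≤ x ↔ p u ≤ x := by
    intro x
    rw [quantile_le_iff _ hu, ← ENNReal.ofReal_le_ofReal_iff (cdf_nonneg _ _), ofReal_cdf,
      Measure.map_apply_of_aemeasurable hm measurableSet_Iic]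
    constructor
    · intro h
      by_contra! hx
      -- Left continuity gives `v < u` with `x < p v`; then `p ≤ x` only to the left of `v`, an
      -- event of mass at most `v < u`.
      obtain ⟨v, hv, hxv⟩ := ((hl.eventually_const_lt hx).and
        (Ioo_mem_nhdsLT hu.1)).exists
      have hle : uniform01 (p ⁻¹' Iic x) ≤ uniform01 (Iic v) := by
        refine measure_mono_ae ?_
        filter_upwards [ae_mem_uniform01] with w hw hwx
        by_contra! hvw
        exact absurd (hp ⟨hxv.1, hxv.2.trans hu.2⟩ hw (not_le.1 hvw).le)
          (not_le.2 (lt_of_le_of_lt hwx hv))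
      rw [uniform01_Iic ⟨hxv.1.le, (hxv.2.trans hu.2).le⟩] at hle
      exact absurd ((ENNReal.ofReal_le_ofReal_iff hxv.1.le).1 (h.trans hle)) (not_le.2 hxv.2)
    · intro h
      rw [← uniform01_Iic ⟨hu.1.le, hu.2.le⟩]
      refine measure_mono_ae ?_
      filter_upwards [ae_mem_uniform01] with w hw hwu
      exact (hp hw hu hwu).trans h
  exact le_antisymm ((key _).2 le_rfl) ((key _).1 le_rfl)

theorem MonotoneOn.ae_continuousAt_uniform01 {p : ℝ → ℝ} (hp : MonotoneOn p (Ioo 0 1)) :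
    ∀ᵐ u ∂uniform01, ContinuousAt p u := by
  filter_upwards [ae_restrict_of_ae (hp.countable_not_continuousWithinAt.ae_notMem volume),
    ae_mem_uniform01] with u hu hu'
  have : ContinuousWithinAt p (Ioo 0 1) u := by
    by_contra h
    exact hu ⟨hu', h⟩
  exact this.continuousAt (isOpen_Ioo.mem_nhds hu')

/-- `Function.rightLim` takes a default value where no limit exists; monotonicity and the lower
bound `quantile μ u` exclude this. -/
theorem tendsto_quantile_nhdsGT (μ : Measure ℝ) {u : ℝ} (hu : u ∈ Ioo (0 : ℝ) 1) :
    Tendsto (quantile μ) (𝓝[>] u) (𝓝 (Function.rightLim (quantile μ) u)) := by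
  have hsub : Ioo u 1 ⊆ Ioo 0 1 := Ioo_subset_Ioo_left hu.1.le
  refine tendsto_rightLim_of_tendsto ⟨_, MonotoneOn.tendsto_nhdsWithin_Ioo_right
    (nonempty_Ioo.2 hu.2) ((monotoneOn_quantile μ).mono hsub) ⟨quantile μ u, ?_⟩⟩
  rintro _ ⟨v, hv, rfl⟩
  exact monotoneOn_quantile μ hu (hsub hv) hv.1.le

theorem tendsto_one_sub_nhdsLT (u : ℝ) : Tendsto (fun v : ℝ => 1 - v) (𝓝[<] u) (𝓝[>] (1 - u)) := by
  refine tendsto_nhdsWithin_iff.2 ⟨((continuous_const.sub continuous_id).tendsto u).mono_left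
    nhdsWithin_le_nhds, ?_⟩
  filter_upwards [self_mem_nhdsWithin] with v hv
  simp only [mem_Iio, mem_Ioi] at *
  linarith

theorem ae_rightLim_quantile (μ : Measure ℝ) :
    ∀ᵐ u ∂uniform01, Function.rightLim (quantile μ) u = quantile μ u := by
  filter_upwards [(monotoneOn_quantile μ).ae_continuousAt_uniform01] with u hu
  exact hu.continuousWithinAt.rightLim_eq

theorem monotoneOn_neg_comp_one_sub {p : ℝ → ℝ} (hp : MonotoneOn p (Ioo 0 1)) :
    MonotoneOn (fun u => -p (1 - u)) (Ioo 0 1) := fun u hu v hv huv =>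
  neg_le_neg (hp (one_sub_mem_Ioo hv) (one_sub_mem_Ioo hu) (by linarith))

theorem map_neg_comp_one_sub {p : ℝ → ℝ} (hp : MonotoneOn p (Ioo 0 1)) :
    uniform01.map (fun u => -p (1 - u)) = (uniform01.map p).map (fun x => -x) := by
  have hm := hp.aemeasurable_uniform01
  rw [AEMeasurable.map_map_of_aemeasurable measurable_neg.aemeasurable hm]
  conv_rhs => rw [← measurePreserving_one_sub_uniform01.map_eq]
  rw [AEMeasurable.map_map_of_aemeasurable _ measurePreserving_one_sub_uniform01.aemeasurable]
  · rfl
  · rw [measurePreserving_one_sub_uniform01.map_eq]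
    exact measurable_neg.comp_aemeasurable hm

theorem map_neg_quantile_comp_one_sub (μ : Measure ℝ) [IsProbabilityMeasure μ] :
    uniform01.map (fun u => -quantile μ (1 - u)) = μ.map (fun x => -x) := by
  rw [map_neg_comp_one_sub (monotoneOn_quantile μ), map_quantile]

/-- If `f v = g (1 - v)` for almost every `v`, then the left limit of `f` at `u` equals the right
limit of `g` at `1 - u`. -/
theorem eq_rightLim_of_ae_eq {f g : ℝ → ℝ} {u L R : ℝ} (hu : u ∈ Ioo (0 : ℝ) 1)
    (h : ∀ᵐ v ∂uniform01, f v = g (1 - v)) (hf : Tendsto f (𝓝[<] u) (𝓝 L))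
    (hg : Tendsto g (𝓝[>] (1 - u)) (𝓝 R)) : L = R := by
  have hg' := hg.comp (tendsto_one_sub_nhdsLT u)
  -- The exceptional set is null, so it contains no interval ending at `u`.
  have h0 : ∃ᶠ v in 𝓝[<] u, f v = g (1 - v) := by
    intro hn
    obtain ⟨a, ha, hsub⟩ := (mem_nhdsLT_iff_exists_Ioo_subset' hu.1).1 hn
    have hz : volume (Ioo (max a 0) u) = 0 := by
      rw [ae_restrict_iff' measurableSet_Ioo] at h
      refine measure_mono_null (fun v hv => ?_) h
      simp only [mem_Ioo, max_lt_iff] at hv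
      exact fun hc => hsub ⟨hv.1.1, hv.2⟩ (hc ⟨hv.1.2, hv.2.trans hu.2⟩)
    rw [Real.volume_Ioo, ENNReal.ofReal_eq_zero, sub_nonpos] at hz
    exact absurd hz (not_le.2 (max_lt ha hu.1))
  by_contra hne
  have := (hf.prodMk_nhds hg').eventually ((isOpen_ne_fun continuous_fst continuous_snd).mem_nhds hne)
  obtain ⟨v, h1, h2⟩ := (h0.and_eventually this).exists
  exact h2 h1

/-- The reflected function is monotone with the right law but may fail to be left continuous, so it
is compared with the quantile only at continuity points. -/
theorem ae_quantile_map_neg (μ : Measure ℝ) [IsProbabilityMeasure μ] :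
    ∀ᵐ u ∂uniform01, quantile (μ.map fun x => -x) u = -quantile μ (1 - u) := by
  have hm := monotoneOn_neg_comp_one_sub (monotoneOn_quantile μ)
  filter_upwards [ae_mem_uniform01, hm.ae_continuousAt_uniform01] with u hu hc
  rw [← map_neg_quantile_comp_one_sub]
  exact quantile_map_uniform01 hm hu (hc.tendsto.mono_left nhdsWithin_le_nhds)

theorem quantile_map_neg (μ : Measure ℝ) [IsProbabilityMeasure μ] {u : ℝ}
    (hu : u ∈ Ioo (0 : ℝ) 1) :
    quantile (μ.map fun x => -x) u = -Function.rightLim (quantile μ) (1 - u) :=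
  eq_rightLim_of_ae_eq hu (g := fun v => -quantile μ v) (ae_quantile_map_neg μ)
    (tendsto_quantile_nhdsLT _ hu) (tendsto_quantile_nhdsGT μ (one_sub_mem_Ioo hu)).neg

end Quantile

/-! ### The maximum of independent uniform variables -/

theorem restrict_Iic_uniform01 (x : ℝ) :
    uniform01.restrict (Iic x) = volume.restrict (Ioc 0 (max 0 (min x 1))) := by
  rw [uniform01, Measure.restrict_restrict measurableSet_Iic,
    Measure.restrict_congr_set ((ae_eq_refl (Iic x)).inter Ioo_ae_eq_Ioc)]
  congr 1
  ext u
  simp only [mem_inter_iff, mem_Iic, mem_Ioc, le_max_iff, le_min_iff]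
  constructor
  · rintro ⟨h1, h2, h3⟩
    exact ⟨h2, Or.inr ⟨h1, h3⟩⟩
  · rintro ⟨h1, h2 | h2⟩
    · linarith
    · exact ⟨h2.1, h1, h2.2⟩

theorem measurable_iSup_eval (k : ℕ) : Measurable (fun x : Fin k → ℝ => ⨆ i, x i) :=
  Measurable.iSup fun i => measurable_pi_apply i

/-- The largest of `n + 1` independent uniform variables has density `(n + 1) u ^ n`. -/
theorem map_iSup_pi_uniform01 (n : ℕ) :
    (Measure.pi fun _ : Fin (n + 1) => uniform01).map (fun ω => ⨆ i, ω i) =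
      uniform01.withDensity (fun u => ENNReal.ofReal ((n + 1) * u ^ n)) := by
  have hm := measurable_iSup_eval (n + 1)
  have := Measure.isProbabilityMeasure_map
    (μ := Measure.pi fun _ : Fin (n + 1) => uniform01) hm.aemeasurable
  refine Measure.ext_of_Iic _ _ fun x => ?_
  set t : ℝ := max 0 (min x 1)
  have ht : 0 ≤ t := le_max_left _ _
  -- The maximum is at most `x` iff every coordinate is, so its distribution function is `t ^ (n +
  -- 1)`.
  have hpre : (fun ω : Fin (n + 1) → ℝ => ⨆ i, ω i) ⁻¹' Iic x = univ.pi fun _ => Iic x := by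
    ext ω
    simp only [mem_preimage, mem_Iic, Set.mem_pi, mem_univ, true_imp_iff]
    exact ciSup_le_iff (Set.finite_range ω).bddAbove
  have hone : uniform01 (Iic x) = ENNReal.ofReal t := by
    rw [← Measure.restrict_apply_univ, restrict_Iic_uniform01,
      Measure.restrict_apply_univ, Real.volume_Ioc, sub_zero]
  rw [Measure.map_apply hm measurableSet_Iic, hpre, Measure.pi_pi, Finset.prod_const, hone,
    withDensity_apply _ measurableSet_Iic, restrict_Iic_uniform01,
    ← ofReal_integral_eq_lintegral_ofReal, ← intervalIntegral.integral_of_le ht,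
    intervalIntegral.integral_const_mul, integral_pow, Finset.card_univ, Fintype.card_fin,
    ← ENNReal.ofReal_pow ht]
  · congr 1
    have : (n : ℝ) + 1 ≠ 0 := by positivity
    field_simp
    simp
  · exact ((by fun_prop : Continuous fun u : ℝ => ((n : ℝ) + 1) * u ^ n).integrableOn_Icc).mono_set
      Ioc_subset_Icc_self
  · filter_upwards [ae_restrict_mem measurableSet_Ioc] with u hu
    have := hu.1.le
    positivity

theorem MonotoneOn.map_iSup_fin {p : ℝ → ℝ} (hp : MonotoneOn p (Ioo 0 1)) {n : ℕ}
    {ω : Fin (n + 1) → ℝ} (hω : ∀ i, ω i ∈ Ioo (0 : ℝ) 1) : ⨆ i, p (ω i) = p (⨆ i, ω i) := by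
  obtain ⟨j, hj⟩ := exists_eq_ciSup_of_finite (f := ω)
  rw [← hj]
  refine le_antisymm (ciSup_le fun i => hp (hω i) (hω j) ?_)
    (le_ciSup (f := fun i => p (ω i)) (Set.finite_range _).bddAbove j)
  rw [hj]
  exact le_ciSup (Set.finite_range ω).bddAbove i

/-! ### Expected maxima and ranges as moments -/

section Law

variable {Ω Ω' : Type*} [MeasurableSpace Ω] [MeasurableSpace Ω']

theorem expectedMax_eq_integral_map {P : Measure Ω} [IsProbabilityMeasure P] {X : Ω → ℝ}
    (hX : AEMeasurable X P) (k : ℕ) :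
    expectedMax P X k = ∫ x : Fin k → ℝ, (⨆ i, x i) ∂Measure.pi fun _ => P.map X := by
  have := Measure.isProbabilityMeasure_map hX
  have hmap := Measure.pi_map_pi (μ := fun _ : Fin k => P) (f := fun _ => X) fun _ => hX
  rw [← hmap, integral_map]
  · rfl
  · exact aemeasurable_pi_lambda _ fun i =>
      hX.comp_quasiMeasurePreserving (Measure.quasiMeasurePreserving_eval _ i)
  · exact (measurable_iSup_eval k).aestronglyMeasurable

theorem expectedMax_congr_map {P : Measure Ω} [IsProbabilityMeasure P] {X : Ω → ℝ}
    {Q : Measure Ω'} [IsProbabilityMeasure Q] {Y : Ω' → ℝ}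
    (hX : AEMeasurable X P) (hY : AEMeasurable Y Q) (h : P.map X = Q.map Y) (k : ℕ) :
    expectedMax P X k = expectedMax Q Y k := by
  rw [expectedMax_eq_integral_map hX, expectedMax_eq_integral_map hY, h]

/-- The maximum of the `p (ω i)` is `p` of the largest uniform variable, whose density is known. -/
theorem expectedMax_uniform01 {p : ℝ → ℝ} (hp : MonotoneOn p (Ioo 0 1)) (n : ℕ) :
    expectedMax uniform01 p (n + 1) = ∫ u, ((n + 1) * u ^ n) * p u ∂uniform01 := by
  have hae : ∀ᵐ ω ∂(Measure.pi fun _ : Fin (n + 1) => uniform01),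
      ⨆ i, p (ω i) = p (⨆ i, ω i) := by
    have : ∀ᵐ ω ∂(Measure.pi fun _ : Fin (n + 1) => uniform01), ∀ i, ω i ∈ Ioo (0 : ℝ) 1 :=
      ae_all_iff.2 fun i => (Measure.quasiMeasurePreserving_eval _ i).ae ae_mem_uniform01
    filter_upwards [this] with ω hω using hp.map_iSup_fin hω
  have hmeas : AEStronglyMeasurable p
      (uniform01.withDensity fun u => ENNReal.ofReal ((n + 1) * u ^ n)) :=
    (hp.aemeasurable_uniform01.mono_ac (withDensity_absolutelyContinuous _ _)).aestronglyMeasurable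
  rw [expectedMax, integral_congr_ae hae,
    ← integral_map (φ := fun ω : Fin (n + 1) → ℝ => ⨆ i, ω i) (f := p)
      (measurable_iSup_eval _).aemeasurable (by rwa [map_iSup_pi_uniform01]),
    map_iSup_pi_uniform01, integral_withDensity_eq_integral_toReal_smul (by fun_prop) (by simp)]
  refine integral_congr_ae ?_
  filter_upwards [ae_mem_uniform01] with u hu
  have := hu.1.le
  rw [ENNReal.toReal_ofReal (by positivity), smul_eq_mul]

theorem integrable_iSup_pi {P : Measure Ω} [IsProbabilityMeasure P] {X : Ω → ℝ}
    (hX : Integrable X P) (k : ℕ) :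
    Integrable (fun ω : Fin k → Ω => ⨆ i, X (ω i)) (Measure.pi fun _ => P) := by
  have hint : ∀ i : Fin k, Integrable (fun ω : Fin k → Ω => X (ω i)) (Measure.pi fun _ => P) :=
    fun i => integrable_comp_eval (μ := fun _ : Fin k => P) hX
  refine (integrable_finsetSum Finset.univ fun i _ => (hint i).norm).mono'
    (AEMeasurable.iSup fun i => (hint i).aemeasurable).aestronglyMeasurable (ae_of_all _ fun ω => ?_)
  -- For `k = 0` the supremum is the default value `0`.
  rcases isEmpty_or_nonempty (Fin k) with h | h
  · simp
  · obtain ⟨j, hj⟩ := exists_eq_ciSup_of_finite (f := fun i => X (ω i))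
    rw [← hj]
    exact Finset.single_le_sum (f := fun i => ‖X (ω i)‖) (fun i _ => norm_nonneg _)
      (Finset.mem_univ j)

theorem expectedRange_eq_expectedMax_add {P : Measure Ω} [IsProbabilityMeasure P] {X : Ω → ℝ}
    (hX : Integrable X P) (k : ℕ) :
    expectedRange P X k = expectedMax P X k + expectedMax P (fun ω => -X ω) k := by
  rw [expectedMax, expectedMax, ← integral_add (integrable_iSup_pi hX k)
    (integrable_iSup_pi (X := fun ω => -X ω) hX.neg k), expectedRange]
  refine integral_congr_ae (ae_of_all _ fun ω => ?_)
  have h : ⨆ i, -X (ω i) = -⨅ i, X (ω i) := by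
    rw [iInf, iSup, ← neg_eq_iff_eq_neg, ← Real.sInf_neg, ← image_neg_eq_neg, ← range_comp]
    simp [Function.comp_def]
  beta_reduce
  rw [h, sub_eq_add_neg]

theorem integrable_of_map_eq {P : Measure Ω} {X : Ω → ℝ} {Q : Measure Ω'} {Y : Ω' → ℝ}
    (hX : Integrable X P) (hY : AEMeasurable Y Q) (h : P.map X = Q.map Y) : Integrable Y Q :=
  (integrable_map_measure (g := id) aestronglyMeasurable_id hY).1
    (h ▸ (integrable_map_measure (g := id) aestronglyMeasurable_id hX.aemeasurable).2 hX)

theorem integrable_comp_one_sub {f : ℝ → ℝ} (hf : Integrable f uniform01) :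
    Integrable (fun u => f (1 - u)) uniform01 :=
  measurePreserving_one_sub_uniform01.integrable_comp_of_integrable hf

theorem integrable_pow_mul_uniform01 {f : ℝ → ℝ} (hf : Integrable f uniform01) (n : ℕ) :
    Integrable (fun u => u ^ n * f u) uniform01 := by
  refine hf.bdd_mul (c := 1) (by fun_prop) ?_
  filter_upwards [ae_mem_uniform01] with u hu
  rw [norm_pow, Real.norm_of_nonneg hu.1.le]
  exact pow_le_one₀ hu.1.le hu.2.le

/-- The expected ranges in terms of any monotone function on the unit interval that has the law of
`X` under the uniform distribution. -/
theorem expectedRange_eq_integral {P : Measure Ω} [IsProbabilityMeasure P] {X : Ω → ℝ}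
    (hX : Integrable X P) {p : ℝ → ℝ} (hp : MonotoneOn p (Ioo 0 1))
    (hmap : P.map X = uniform01.map p) (n : ℕ) :
    expectedRange P X (n + 1) = ∫ u, ((n + 1) * u ^ n) * (p u - p (1 - u)) ∂uniform01 := by
  have hp' := monotoneOn_neg_comp_one_sub hp
  have hpm := hp.aemeasurable_uniform01
  have hmap' : P.map (fun ω => -X ω) = uniform01.map fun u => -p (1 - u) := by
    rw [map_neg_comp_one_sub hp, ← hmap,
      AEMeasurable.map_map_of_aemeasurable measurable_neg.aemeasurable hX.aemeasurable]
    rfl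
  have hpi : Integrable p uniform01 := integrable_of_map_eq hX hpm hmap
  rw [expectedRange_eq_expectedMax_add hX,
    expectedMax_congr_map hX.aemeasurable hpm hmap, expectedMax_uniform01 hp,
    expectedMax_congr_map (X := fun ω => -X ω) hX.aemeasurable.neg hp'.aemeasurable_uniform01
      hmap',
    expectedMax_uniform01 hp', ← integral_add]
  · refine integral_congr_ae (ae_of_all _ fun u => ?_)
    ring
  · simpa only [mul_assoc] using (integrable_pow_mul_uniform01 hpi n).const_mul ((n : ℝ) + 1)
  · simpa only [mul_assoc, mul_neg, Pi.neg_apply] using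
      (integrable_pow_mul_uniform01 (integrable_comp_one_sub hpi) n).neg.const_mul ((n : ℝ) + 1)

theorem integrable_quantile {P : Measure Ω} [IsProbabilityMeasure P] {X : Ω → ℝ}
    (hX : Integrable X P) : Integrable (quantile (P.map X)) uniform01 := by
  have := Measure.isProbabilityMeasure_map hX.aemeasurable
  exact integrable_of_map_eq hX (monotoneOn_quantile _).aemeasurable_uniform01
    (map_quantile _).symm

end Law

/-! ### Moments determine the function -/

/-- An integrable function on the unit interval all of whose moments vanish is zero. -/
theorem ae_eq_zero_of_moments_eq_zero {f : ℝ → ℝ} (hf : Integrable f uniform01)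
    (h : ∀ n : ℕ, ∫ u, u ^ n * f u ∂uniform01 = 0) : ∀ᵐ u ∂uniform01, f u = 0 := by
  have hpoly : ∀ p : Polynomial ℝ, ∫ u, p.eval u * f u ∂uniform01 = 0 := by
    intro p
    simp_rw [Polynomial.eval_eq_sum_range, Finset.sum_mul, mul_assoc]
    rw [integral_finsetSum _ fun i _ => (integrable_pow_mul_uniform01 hf i).const_mul _]
    simp [integral_const_mul, h]
  rw [ae_restrict_iff' measurableSet_Ioo]
  refine isOpen_Ioo.ae_eq_zero_of_integral_contDiff_smul_eq_zero
    (IntegrableOn.locallyIntegrableOn hf) fun g hg _ hsupp => ?_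
  have hset : ∫ x, g x • f x = ∫ x, g x * f x ∂uniform01 := by
    refine (setIntegral_eq_integral_of_forall_compl_eq_zero fun x hx => ?_).symm
    rw [image_eq_zero_of_notMem_tsupport fun hc => hx (hsupp hc), zero_smul]
  rw [hset]
  refine abs_eq_zero.1 (le_antisymm (le_of_forall_pos_le_add fun ε hε => ?_) (abs_nonneg _))
  set C := ∫ u, ‖f u‖ ∂uniform01
  have hC : 0 ≤ C := integral_nonneg fun u => norm_nonneg _
  -- `C + 1` rather than `C`, since `C` may vanish.
  have hδ : 0 < ε / (C + 1) := by positivity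
  obtain ⟨p, hp⟩ := exists_polynomial_near_of_continuousOn 0 1 g hg.continuous.continuousOn _ hδ
  have hdiff : ∀ᵐ u ∂uniform01, ‖g u - p.eval u‖ ≤ ε / (C + 1) := by
    filter_upwards [ae_mem_uniform01] with u hu
    rw [norm_sub_rev, Real.norm_eq_abs]
    exact (hp u ⟨hu.1.le, hu.2.le⟩).le
  have hgm : AEStronglyMeasurable (fun u => g u - p.eval u) uniform01 :=
    (hg.continuous.sub p.continuous).aestronglyMeasurable
  have hpf : Integrable (fun u => p.eval u * f u) uniform01 := by
    simp_rw [Polynomial.eval_eq_sum_range, Finset.sum_mul, mul_assoc]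
    exact integrable_finsetSum _ fun i _ => (integrable_pow_mul_uniform01 hf i).const_mul _
  -- Polynomials integrate to zero against `f`, so subtracting the approximant changes nothing.
  have hsplit : ∫ u, g u * f u ∂uniform01 = ∫ u, (g u - p.eval u) * f u ∂uniform01 := by
    rw [← add_zero (∫ u, (g u - p.eval u) * f u ∂uniform01), ← hpoly p,
      ← integral_add (hf.bdd_mul hgm hdiff) hpf]
    exact integral_congr_ae (ae_of_all _ fun u => by ring)
  rw [hsplit, ← Real.norm_eq_abs, zero_add]
  calc ‖∫ u, (g u - p.eval u) * f u ∂uniform01‖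
      ≤ ∫ u, ε / (C + 1) * ‖f u‖ ∂uniform01 := by
        refine norm_integral_le_of_norm_le (hf.norm.const_mul _) ?_
        filter_upwards [hdiff] with u hu
        rw [norm_mul]
        exact mul_le_mul_of_nonneg_right hu (norm_nonneg _)
    _ = ε / (C + 1) * C := integral_const_mul _ _
    _ ≤ ε := by
        rw [div_mul_eq_mul_div, div_le_iff₀ (by positivity)]
        nlinarith

/-! ### Comparison of expected ranges and symmetrization -/

section Criterion

variable {Ω Ω' : Type*} [MeasurableSpace Ω] [MeasurableSpace Ω']
  {P : Measure Ω} {X : Ω → ℝ} {Q : Measure Ω'} {Y : Ω' → ℝ}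

theorem map_neg_of_isSymmetricRV (hX : AEMeasurable X P) (h : IsSymmetricRV P X) :
    (P.map X).map (fun x => -x) = P.map X := by
  rw [AEMeasurable.map_map_of_aemeasurable measurable_neg.aemeasurable hX]
  exact h.map_eq.symm

theorem isSymmetricRV_of_map_eq (hX : AEMeasurable X P) (hY : AEMeasurable Y Q)
    (h : P.map X = Q.map Y) (hs : IsSymmetricRV P X) : IsSymmetricRV Q Y := by
  refine ⟨hY, hY.neg, ?_⟩
  have := map_neg_of_isSymmetricRV hX hs
  rw [h, AEMeasurable.map_map_of_aemeasurable measurable_neg.aemeasurable hY] at this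
  exact this.symm

theorem IsSymmetricRV.const_mul (h : IsSymmetricRV P X) (c : ℝ) :
    IsSymmetricRV P fun ω => c * X ω := by
  have := h.comp (measurable_const_mul c)
  simpa only [IsSymmetricRV, Function.comp_def, mul_neg] using this

variable [IsProbabilityMeasure P] [IsProbabilityMeasure Q]

theorem monotoneOn_invCdf (P : Measure Ω) (X : Ω → ℝ) : MonotoneOn (invCdf P X) (Ioo 0 1) :=
  monotoneOn_quantile (P.map X)

theorem map_invCdf (hX : AEMeasurable X P) : uniform01.map (invCdf P X) = P.map X := by
  have := Measure.isProbabilityMeasure_map hX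
  exact map_quantile (P.map X)

/-- Two integrable variables represented by monotone functions `p`, `r` on the unit interval have
the same expected ranges iff `p - r` is almost everywhere symmetric about `1 / 2`. -/
theorem sameExpectedRanges_iff_of_monotoneOn (hX : Integrable X P) (hY : Integrable Y Q)
    {p r : ℝ → ℝ} (hp : MonotoneOn p (Ioo 0 1)) (hr : MonotoneOn r (Ioo 0 1))
    (hpX : P.map X = uniform01.map p) (hrY : Q.map Y = uniform01.map r) :
    SameExpectedRanges P X Q Y ↔ ∀ᵐ u ∂uniform01, p u - r u = p (1 - u) - r (1 - u) := by
  have hpi : Integrable p uniform01 := integrable_of_map_eq hX hp.aemeasurable_uniform01 hpX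
  have hri : Integrable r uniform01 := integrable_of_map_eq hY hr.aemeasurable_uniform01 hrY
  constructor
  · intro h
    have hps := hpi.sub (integrable_comp_one_sub hpi)
    have hrs := hri.sub (integrable_comp_one_sub hri)
    -- Equal expected ranges say that the odd parts of `p` and `r` have equal moments, once the
    -- factor `n + 1` is cancelled.
    have h0 := ae_eq_zero_of_moments_eq_zero (hps.sub hrs) fun n => ?_
    · filter_upwards [h0] with u hu
      simp only [Pi.sub_apply] at hu
      linarith
    · have hn := h (n + 1) (by omega)
      rw [expectedRange_eq_integral hX hp hpX, expectedRange_eq_integral hY hr hrY] at hn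
      simp_rw [mul_assoc] at hn
      rw [integral_const_mul, integral_const_mul] at hn
      have hn' := mul_left_cancel₀ (by positivity) hn
      simp only [Pi.sub_apply, mul_sub (_ ^ n) (_ - _) (_ - _)]
      rw [integral_sub, hn', sub_self]
      · exact integrable_pow_mul_uniform01 hps n
      · exact integrable_pow_mul_uniform01 hrs n
  · intro h k hk
    obtain ⟨n, rfl⟩ := Nat.exists_eq_add_of_le' hk
    rw [expectedRange_eq_integral hX hp hpX, expectedRange_eq_integral hY hr hrY]
    refine integral_congr_ae ?_
    filter_upwards [h] with u hu
    congr 1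
    linarith

theorem sameExpectedRanges_iff_ae (hX : Integrable X P) (hY : Integrable Y Q) :
    SameExpectedRanges P X Q Y ↔ ∀ᵐ u ∂uniform01,
      invCdf P X u - invCdf Q Y u = invCdf P X (1 - u) - invCdf Q Y (1 - u) :=
  sameExpectedRanges_iff_of_monotoneOn hX hY (monotoneOn_invCdf P X) (monotoneOn_invCdf Q Y)
    (map_invCdf hX.aemeasurable).symm (map_invCdf hY.aemeasurable).symm

theorem ae_rightLim_invCdf_one_sub (P : Measure Ω) (X : Ω → ℝ) :
    ∀ᵐ u ∂uniform01, Function.rightLim (invCdf P X) (1 - u) = invCdf P X (1 - u) :=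
  measurePreserving_one_sub_uniform01.quasiMeasurePreserving.ae (ae_rightLim_quantile (P.map X))

theorem sameExpectedRanges_iff_rightLim (hX : Integrable X P) (hY : Integrable Y Q) :
    SameExpectedRanges P X Q Y ↔ ∀ u ∈ Ioo (0 : ℝ) 1, invCdf P X u - invCdf Q Y u =
      Function.rightLim (invCdf P X) (1 - u) - Function.rightLim (invCdf Q Y) (1 - u) := by
  rw [sameExpectedRanges_iff_ae hX hY]
  constructor
  · intro h u hu
    refine eq_rightLim_of_ae_eq (f := fun v => invCdf P X v - invCdf Q Y v)
      (g := fun v => invCdf P X v - invCdf Q Y v) hu h ?_ ?_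
    · exact (tendsto_quantile_nhdsLT _ hu).sub (tendsto_quantile_nhdsLT _ hu)
    · exact (tendsto_quantile_nhdsGT _ (one_sub_mem_Ioo hu)).sub
        (tendsto_quantile_nhdsGT _ (one_sub_mem_Ioo hu))
  · intro h
    filter_upwards [ae_mem_uniform01, ae_rightLim_invCdf_one_sub P X,
      ae_rightLim_invCdf_one_sub Q Y] with u hu h1 h2
    rw [h u hu, h1, h2]

theorem ae_invCdf_of_isSymmetricRV (hX : AEMeasurable X P) (h : IsSymmetricRV P X) :
    ∀ᵐ u ∂uniform01, invCdf P X u = -invCdf P X (1 - u) := by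
  have := Measure.isProbabilityMeasure_map hX
  have h' := ae_quantile_map_neg (P.map X)
  rwa [map_neg_of_isSymmetricRV hX h] at h'

/-- Symmetric integrable variables with the same expected ranges have the same law. -/
theorem identDistrib_of_sameExpectedRanges (hX : Integrable X P) (hY : Integrable Y Q)
    (hXs : IsSymmetricRV P X) (hYs : IsSymmetricRV Q Y) (h : SameExpectedRanges P X Q Y) :
    IdentDistrib X Y P Q := by
  refine ⟨hX.aemeasurable, hY.aemeasurable, ?_⟩
  rw [← map_invCdf hX.aemeasurable, ← map_invCdf hY.aemeasurable]
  refine Measure.map_congr ?_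
  -- The difference of the quantile functions is even about `1 / 2` by equality of ranges and odd by
  -- symmetry, hence zero.
  filter_upwards [(sameExpectedRanges_iff_ae hX hY).1 h,
    ae_invCdf_of_isSymmetricRV hX.aemeasurable hXs,
    ae_invCdf_of_isSymmetricRV hY.aemeasurable hYs] with u h1 h2 h3
  linarith

theorem expectedRange_eq_of_isSymmetricRV (hX : Integrable X P) (h : IsSymmetricRV P X) (k : ℕ) :
    expectedRange P X k = 2 * expectedMax P X k := by
  rw [expectedRange_eq_expectedMax_add hX,
    ← expectedMax_congr_map (Y := fun ω => -X ω) hX.aemeasurable hX.aemeasurable.neg h.map_eq,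
    two_mul]

theorem expectedMax_const_mul {c : ℝ} (hc : 0 ≤ c) (P : Measure Ω) (X : Ω → ℝ) (k : ℕ) :
    expectedMax P (fun ω => c * X ω) k = c * expectedMax P X k := by
  simp only [expectedMax, ← Real.mul_iSup_of_nonneg hc, integral_const_mul]

/-- The symmetrized quantile function of `Y`. -/
noncomputable def symmQuantile (Q : Measure Ω') (Y : Ω' → ℝ) (u : ℝ) : ℝ :=
  (1 / 2) * (invCdf Q Y u - Function.rightLim (invCdf Q Y) (1 - u))

/-- As an average of the quantile functions of `Y` and `-Y`, the symmetrization inherits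
monotonicity and left continuity. -/
theorem symmQuantile_eq (hY : AEMeasurable Y Q) {u : ℝ} (hu : u ∈ Ioo (0 : ℝ) 1) :
    symmQuantile Q Y u =
      (1 / 2) * (quantile (Q.map Y) u + quantile ((Q.map Y).map fun x => -x) u) := by
  have := Measure.isProbabilityMeasure_map hY
  rw [quantile_map_neg _ hu, symmQuantile, sub_eq_add_neg]
  rfl

theorem monotoneOn_symmQuantile (hY : AEMeasurable Y Q) :
    MonotoneOn (symmQuantile Q Y) (Ioo 0 1) := by
  intro u hu v hv huv
  rw [symmQuantile_eq hY hu, symmQuantile_eq hY hv]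
  have h1 := monotoneOn_quantile (Q.map Y) hu hv huv
  have h2 := monotoneOn_quantile ((Q.map Y).map fun x => -x) hu hv huv
  linarith

theorem tendsto_symmQuantile_nhdsLT (hY : AEMeasurable Y Q) {u : ℝ} (hu : u ∈ Ioo (0 : ℝ) 1) :
    Tendsto (symmQuantile Q Y) (𝓝[<] u) (𝓝 (symmQuantile Q Y u)) := by
  rw [symmQuantile_eq hY hu]
  refine (((tendsto_quantile_nhdsLT _ hu).add (tendsto_quantile_nhdsLT _ hu)).const_mul
    (1 / 2 : ℝ)).congr' ?_
  filter_upwards [Ioo_mem_nhdsLT hu.1] with v hv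
  exact (symmQuantile_eq hY ⟨hv.1, hv.2.trans hu.2⟩).symm

theorem ae_symmQuantile (Q : Measure Ω') (Y : Ω' → ℝ) :
    ∀ᵐ u ∂uniform01, symmQuantile Q Y u = (1 / 2) * (invCdf Q Y u - invCdf Q Y (1 - u)) := by
  filter_upwards [ae_rightLim_invCdf_one_sub Q Y] with u hu
  rw [symmQuantile, hu]

theorem ae_symmQuantile_one_sub (Q : Measure Ω') (Y : Ω' → ℝ) :
    ∀ᵐ u ∂uniform01, symmQuantile Q Y (1 - u) = -symmQuantile Q Y u := by
  filter_upwards [ae_symmQuantile Q Y,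
    measurePreserving_one_sub_uniform01.quasiMeasurePreserving.ae (ae_symmQuantile Q Y)]
    with u h1 h2
  rw [h1, h2, sub_sub_cancel]
  ring

theorem integrable_symmQuantile (hY : Integrable Y Q) :
    Integrable (symmQuantile Q Y) uniform01 := by
  have hq : Integrable (invCdf Q Y) uniform01 := integrable_quantile hY
  refine ((hq.sub (integrable_comp_one_sub hq)).const_mul (1 / 2)).congr ?_
  filter_upwards [ae_symmQuantile Q Y] with u hu using hu.symm

theorem isSymmetricRV_symmQuantile (hY : AEMeasurable Y Q) :
    IsSymmetricRV uniform01 (symmQuantile Q Y) := by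
  have hm := (monotoneOn_symmQuantile hY).aemeasurable_uniform01
  refine ⟨hm, hm.neg, ?_⟩
  have h1 := map_neg_comp_one_sub (monotoneOn_symmQuantile hY)
  rw [AEMeasurable.map_map_of_aemeasurable measurable_neg.aemeasurable hm] at h1
  refine Eq.trans (Measure.map_congr ?_) h1
  filter_upwards [ae_symmQuantile_one_sub Q Y] with u hu
  rw [hu, neg_neg]

theorem invCdf_symmQuantile (hY : AEMeasurable Y Q) {u : ℝ} (hu : u ∈ Ioo (0 : ℝ) 1) :
    invCdf uniform01 (symmQuantile Q Y) u = symmQuantile Q Y u :=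
  quantile_map_uniform01 (monotoneOn_symmQuantile hY) hu (tendsto_symmQuantile_nhdsLT hY hu)

theorem sameExpectedRanges_symmQuantile (hY : Integrable Y Q) :
    SameExpectedRanges uniform01 (symmQuantile Q Y) Q Y := by
  refine (sameExpectedRanges_iff_of_monotoneOn (integrable_symmQuantile hY) hY
    (monotoneOn_symmQuantile hY.aemeasurable) (monotoneOn_invCdf Q Y) rfl
    (map_invCdf hY.aemeasurable).symm).2 ?_
  -- Oddness doubles `symmQuantile` in the difference, which the factor `1 / 2` compensates.
  filter_upwards [ae_symmQuantile Q Y, ae_symmQuantile_one_sub Q Y] with u h1 h2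
  rw [h2, h1]
  ring

theorem expectedRange_congr_map (hX : Integrable X P) (hY : Integrable Y Q)
    (h : P.map X = Q.map Y) (k : ℕ) : expectedRange P X k = expectedRange Q Y k := by
  rw [expectedRange_eq_expectedMax_add hX, expectedRange_eq_expectedMax_add hY,
    expectedMax_congr_map hX.aemeasurable hY.aemeasurable h,
    expectedMax_congr_map (X := fun ω => -X ω) (Y := fun ω => -Y ω) hX.aemeasurable.neg
      hY.aemeasurable.neg]
  have h' := congrArg (Measure.map fun x : ℝ => -x) h
  rwa [AEMeasurable.map_map_of_aemeasurable measurable_neg.aemeasurable hX.aemeasurable,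
    AEMeasurable.map_map_of_aemeasurable measurable_neg.aemeasurable hY.aemeasurable] at h'

end Criterion

/-! ### Realization in arbitrary universes and conclusion -/

/-- Every law on the line is realized on a probability space in any given universe. -/
theorem exists_map_eq_of_isProbabilityMeasure.{u} (μ : Measure ℝ) [IsProbabilityMeasure μ] :
    ∃ (Ω : Type u) (_ : MeasurableSpace Ω) (P : Measure Ω) (X : Ω → ℝ),
      IsProbabilityMeasure P ∧ Measurable X ∧ P.map X = μ := by
  refine ⟨ULift.{u} ℝ, inferInstance, μ.map ULift.up, ULift.down,
    Measure.isProbabilityMeasure_map measurable_up.aemeasurable, measurable_down, ?_⟩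
  rw [Measure.map_map measurable_down measurable_up]
  exact Measure.map_id

/-- An integrable variable has a copy on a probability space in any given universe. -/
theorem exists_integrable_map_eq.{u, v} {Ω : Type u} [MeasurableSpace Ω] {P : Measure Ω}
    [IsProbabilityMeasure P] {X : Ω → ℝ} (hX : Integrable X P) :
    ∃ (Ω' : Type v) (_ : MeasurableSpace Ω') (P' : Measure Ω') (X' : Ω' → ℝ),
      IsProbabilityMeasure P' ∧ Integrable X' P' ∧ P.map X = P'.map X' := by
  have := Measure.isProbabilityMeasure_map hX.aemeasurable
  obtain ⟨Ω', _, P', X', hP', hm, h⟩ := exists_map_eq_of_isProbabilityMeasure.{v} (P.map X)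
  exact ⟨Ω', _, P', X', hP', integrable_of_map_eq hX hm.aemeasurable h.symm, h.symm⟩

theorem exists_symmetric_sameExpectedRanges.{u, v} {Ω : Type u} [MeasurableSpace Ω]
    {Q : Measure Ω} [IsProbabilityMeasure Q] {Y : Ω → ℝ} (hY : Integrable Y Q) :
    ∃ (Ω' : Type v) (_ : MeasurableSpace Ω') (P : Measure Ω') (X : Ω' → ℝ),
      IsProbabilityMeasure P ∧ Integrable X P ∧ IsSymmetricRV P X ∧
      SameExpectedRanges P X Q Y ∧ ∀ u ∈ Ioo (0 : ℝ) 1, invCdf P X u =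
        (1 / 2) * (invCdf Q Y u - Function.rightLim (invCdf Q Y) (1 - u)) := by
  have hi := integrable_symmQuantile hY
  obtain ⟨Ω', _, P, X, hP, hX, h⟩ := exists_integrable_map_eq.{0, v} hi
  refine ⟨Ω', _, P, X, hP, hX, isSymmetricRV_of_map_eq hi.aemeasurable hX.aemeasurable h
    (isSymmetricRV_symmQuantile hY.aemeasurable), fun k hk => ?_, fun u hu => ?_⟩
  · rw [← expectedRange_congr_map hi hX h, sameExpectedRanges_symmQuantile hY k hk]
  · rw [invCdf_eq_quantile, ← h, ← invCdf_eq_quantile, invCdf_symmQuantile hY.aemeasurable hu,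
      symmQuantile]

theorem isExpectedRangesSeq_iff.{u, v} (ρ : ℕ → ℝ) :
    IsExpectedRangesSeq.{u} ρ ↔ IsSymmetricExpectedMaximaSeq.{v} ρ := by
  constructor
  · rintro ⟨Ω, _, Q, Y, hQ, hY, hρ⟩
    obtain ⟨Ω', _, P, X, hP, hX, hs, hsame, -⟩ := exists_symmetric_sameExpectedRanges.{u, v} hY
    -- Doubling, because a symmetric variable has expected range twice its expected maximum; the
    -- converse halves.
    refine ⟨Ω', _, P, fun ω => 2 * X ω, hP, hX.const_mul 2, hs.const_mul 2, fun k hk => ?_⟩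
    rw [expectedMax_const_mul zero_le_two, ← expectedRange_eq_of_isSymmetricRV hX hs, hsame k hk,
      hρ k hk]
  · rintro ⟨Ω, _, P, X, hP, hX, hs, hρ⟩
    have hX' := hX.const_mul (1 / 2)
    obtain ⟨Ω', _, P', X', hP', hi, h⟩ := exists_integrable_map_eq.{v, u} hX'
    refine ⟨Ω', _, P', X', hP', hi, fun k hk => ?_⟩
    rw [← expectedRange_congr_map hX' hi h,
      expectedRange_eq_of_isSymmetricRV hX' (hs.const_mul _),
      expectedMax_const_mul (by norm_num), hρ k hk]
    ring

theorem theorem4p2 :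
    -- (i)
    (∀ ρ : ℕ → ℝ, IsExpectedRangesSeq.{u₁} ρ ↔ IsSymmetricExpectedMaximaSeq.{u₂} ρ) ∧
    -- (ii): existence, the explicit relation, and uniqueness in distribution
    (∀ (Ω : Type u₁) [MeasurableSpace Ω] (Q : Measure Ω) [IsProbabilityMeasure Q] (Y : Ω → ℝ),
      Integrable Y Q →
        ∃ (Ω' : Type u₂) (_ : MeasurableSpace Ω') (P : Measure Ω') (X : Ω' → ℝ),
          IsProbabilityMeasure P ∧ Integrable X P ∧ IsSymmetricRV P X ∧
          SameExpectedRanges P X Q Y ∧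
          (∀ u ∈ Ioo (0 : ℝ) 1, invCdf P X u =
            (1 / 2) * (invCdf Q Y u - Function.rightLim (invCdf Q Y) (1 - u))) ∧
          ∀ (Ω'' : Type u₃) [MeasurableSpace Ω''] (P' : Measure Ω'') [IsProbabilityMeasure P']
            (X' : Ω'' → ℝ), Integrable X' P' → IsSymmetricRV P' X' →
              SameExpectedRanges P' X' Q Y → IdentDistrib X' X P' P) ∧
    -- (iii): both forms of the criterion
    (∀ (Ω : Type u₁) [MeasurableSpace Ω] (P : Measure Ω) [IsProbabilityMeasure P] (X : Ω → ℝ)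
      (Ω' : Type u₂) [MeasurableSpace Ω'] (Q : Measure Ω') [IsProbabilityMeasure Q] (Y : Ω' → ℝ),
      Integrable X P → Integrable Y Q →
        (SameExpectedRanges P X Q Y ↔
          ∀ u ∈ Ioo (0 : ℝ) 1, invCdf P X u - invCdf Q Y u =
            Function.rightLim (invCdf P X) (1 - u) - Function.rightLim (invCdf Q Y) (1 - u)) ∧
        (SameExpectedRanges P X Q Y ↔
          ∀ᵐ u ∂(volume.restrict (Ioo (0 : ℝ) 1)),
            invCdf P X u - invCdf Q Y u = invCdf P X (1 - u) - invCdf Q Y (1 - u))) := by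
  refine ⟨isExpectedRangesSeq_iff, fun Ω _ Q _ Y hY => ?_, fun Ω _ P _ X Ω' _ Q _ Y hX hY =>
    ⟨sameExpectedRanges_iff_rightLim hX hY, sameExpectedRanges_iff_ae hX hY⟩⟩
  obtain ⟨Ω', _, P, X, hP, hX, hs, hsame, hinv⟩ := exists_symmetric_sameExpectedRanges hY
  exact ⟨Ω', _, P, X, hP, hX, hs, hsame, hinv, fun Ω'' _ P' _ X' hX' hs' hsame' =>
    identDistrib_of_sameExpectedRanges hX' hX hs' hs fun k hk =>
      (hsame' k hk).trans (hsame k hk).symm⟩
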